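/- Let $\mathbb{D}=\{z\in\mathbb{C}:|z|<1\}$. Let $\mathcal{H}$ be the class of complex-valued harmonic mappings $f=h+\overline{g}$ on $\mathbb{D}$, with $h,g$ analytic in $\mathbb{D}$, such that $h(0)=g(0)=0$ and $h'(0)=1$. For $\lambda>0$ let $\mathcal{B}_H(\lambda)$ be the set of all $f=h+\overline{g}\in\mathcal{H}$ such that $h'+e^{i\theta}g'$ has no zero in $\mathbb{D}$ for every $\theta\in[0,2\pi]$ and $$\|T_f\|:=\sup_{z\in\mathbb{D},\ \theta\in[0,2\pi]}(1-|z|^2)\left|\frac{h''(z)+e^{i\theta}g''(z)}{h'(z)+e^{i\theta}g'(z)}\right|\le 2\lambda .$$ For $f=h+\overline{g}\in\mathcal{H}$ with $h(z)=\sum_{n\ge1}a_nz^n$ and $g(z)=\sum_{n\ge1}b_nz^n$, let $\gamma(f)\in[-\infty,\infty]$ be the infimum of all real $\gamma$ such that $|a_n|+|b_n|=O(n^{\gamma-1})$ as $n\to\infty$, and for $X\subset\mathcal{H}$ put $\gamma(X)=\sup_{f\in X}\gamma(f)$. **Theorem.** For each $\lambda\in(0,\infty)$, $$\max\{\lambda-1,0\}\le\gamma(\mathcal{B}_H(\lambda))\le\alpha(\lambda),\qquad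 \alpha(\lambda)=\frac{\sqrt{1+4\lambda^2}-1}{2}.$$ In particular, $\gamma(\mathcal{B}_H(\lambda))=O(\lambda^2)$ as $\lambda\to0^+$. The same bounds and the same asymptotic estimate hold when $\mathcal{B}_H(\lambda)$ is replaced by its subclass of those $f$ with $b_1=g'(0)=0$. -/

import Mathlib

open Filter Topology Set
open scoped ENNReal ComplexConjugate

noncomputable section

namespace HarmonicDisk

/-- `f = h + conj g` on the unit disk, with `h` and `g` analytic there and `g 0 = 0`: the canonical
decomposition of `f`. On the disk, `h` and `g` are uniquely determined by `f`. -/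
def IsCanonicalDecomposition (f h g : ℂ → ℂ) : Prop :=
  DifferentiableOn ℂ h (Metric.ball 0 1) ∧ DifferentiableOn ℂ g (Metric.ball 0 1) ∧ g 0 = 0 ∧
    ∀ z ∈ Metric.ball (0 : ℂ) 1, f z = h z + conj (g z)

/-- The class `𝓗` of harmonic mappings `f = h + conj g` of the unit disk that are normalized by
`h 0 = g 0 = 0` and `h' 0 = 1`. (Values of `f` outside of the disk play no role.) -/
def classH : Set (ℂ → ℂ) :=
  {f | InnerProductSpace.HarmonicOnNhd f (Metric.ball 0 1) ∧
    ∃ h g : ℂ → ℂ, IsCanonicalDecomposition f h g ∧ h 0 = 0 ∧ deriv h 0 = 1}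

/-- The norm `‖T_f‖ ∈ [0, ∞]` of the pre-Schwarzian derivative of `f = h + conj g`: the supremum over
`|z| < 1` and `0 ≤ θ ≤ 2π` of
`(1 - |z|²) |(h''(z) + e^{iθ} g''(z)) / (h'(z) + e^{iθ} g'(z))|`.
It is used only where these denominators do not vanish. -/
def preSchwarzianNorm (h g : ℂ → ℂ) : ℝ≥0∞ :=
  ⨆ z ∈ Metric.ball (0 : ℂ) 1, ⨆ θ ∈ Icc (0 : ℝ) (2 * Real.pi),
    ENNReal.ofReal ((1 - ‖z‖ ^ 2) *
      ‖(deriv (deriv h) z + Complex.exp (Complex.I * θ) * deriv (deriv g) z) /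
        (deriv h z + Complex.exp (Complex.I * θ) * deriv g z)‖)

/-- The class `𝓑_H(lam)` of all `f = h + conj g` in `𝓗` with `‖T_f‖ ≤ 2 lam`. That the quotients in
`‖T_f‖` make sense, that is, that no `h' + e^{iθ} g'` has a zero in the disk, is part of this
condition (it excludes, for example, `f z = z - conj z`, for which `h' + g'` is identically zero). -/
def classBH (lam : ℝ) : Set (ℂ → ℂ) :=
  {f | f ∈ classH ∧ ∃ h g : ℂ → ℂ, IsCanonicalDecomposition f h g ∧
    (∀ z ∈ Metric.ball (0 : ℂ) 1, ∀ θ ∈ Icc (0 : ℝ) (2 * Real.pi),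
      deriv h z + Complex.exp (Complex.I * θ) * deriv g z ≠ 0) ∧
    preSchwarzianNorm h g ≤ ENNReal.ofReal (2 * lam)}

/-- The functions `f = h + conj g` in `𝓑_H(lam)` with `g' 0 = 0`, that is, with `b₁ = 0`. -/
def classBHZero (lam : ℝ) : Set (ℂ → ℂ) :=
  {f | f ∈ classBH lam ∧ ∃ h g : ℂ → ℂ, IsCanonicalDecomposition f h g ∧ deriv g 0 = 0}

/-- The `n`-th Taylor coefficient of `h` at `0`. -/
def taylorCoeff (h : ℂ → ℂ) (n : ℕ) : ℂ := iteratedDeriv n h 0 / (n.factorial : ℂ)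

/-- The coefficient growth exponent `γ(f)` of `f = ∑ aₙ zⁿ + conj (∑ bₙ zⁿ)`: the infimum of all real
`s` with `|aₙ| + |bₙ| = O(n^(s-1))`. It is an extended real number: it is `-∞` for `f z = z`. -/
def growthExponent (f : ℂ → ℂ) : EReal :=
  sInf ((fun s : ℝ => (s : EReal)) '' {s : ℝ | ∃ h g : ℂ → ℂ, IsCanonicalDecomposition f h g ∧
    (fun n : ℕ => ‖taylorCoeff h n‖ + ‖taylorCoeff g n‖) =O[atTop]
      (fun n : ℕ => (n : ℝ) ^ (s - 1))})

/-- `γ(X)`, the supremum of `γ(f)` over all `f` in `X`. -/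
def classGrowthExponent (X : Set (ℂ → ℂ)) : EReal := ⨆ f ∈ X, growthExponent f

/-- `α(lam) = (√(1 + 4 lam²) - 1) / 2`. -/
def alpha (lam : ℝ) : ℝ := (Real.sqrt (1 + 4 * lam ^ 2) - 1) / 2

end HarmonicDisk

end

/-!
Upper bound. Let `f = h + conj g` be in `𝓑_H(lam)`. Each `ψ = h' + e^{iθ} g'` is analytic and
nonvanishing with `(1 - |z|²) |ψ'| ≤ 2 lam |ψ|`, so it has an analytic square root `χ = ∑ dₙ zⁿ`, and
`(1 - |z|²) |χ'| ≤ lam |χ|`. Put `u(x) = ∑ |dₙ|² xⁿ`, the mean of `|χ|²` (that is, of `|ψ|`) on the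
circle `|z|² = x`. Parseval's identity, applied to `χ` and `χ'`, turns the pointwise bound into the
differential inequality `(x u')' ≤ lam² u / (1 - x)²` (`exists_tsum_norm_sq_le`). If `β > α(lam)`, then
`β (β + 1) > lam²`, so `(1 - x)^(-β)` is a supersolution near `1`, and a maximum principle gives
`u(x) = O((1 - x)^(-β))` (`exists_le_mul_one_sub_rpow`). By the Cauchy-Schwarz inequality for the
Cauchy product `χ²`, the `n`-th coefficient of `ψ` is at most `r^(-n) u(r²)`, which for
`r = 1 - 1 / (2 n)` is `O(n^β)` (`taylorCoeff_isBigO`). The cases `θ = 0` and `θ = π` together bound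
the coefficients of `h` and of `g`.

Lower bound. Both extremal maps are analytic, so they also have `b₁ = 0`
(`le_classGrowthExponent`). For `h' = (1 - z)^(-lam)` the coefficients of `h'` grow like `n^(lam - 1)`.
For the bound `0`, take `h' = 1 + ∑ₖ ε 2^(-k) z^(mₖ)` with `mₖ = 2^(k²)`: since
`(1 - |z|²) n |z|^(n - 1) ≤ 2`, only the sum of the coefficients matters for the bound on `h''/h'`,
while the gaps make these coefficients decay more slowly than any negative power of the index.
-/

namespace HarmonicDisk

/-! ### Taylor coefficients and Parseval's identity -/

theorem taylorCoeff_eq_of_hasFPowerSeriesAt {f : ℂ → ℂ} {c : ℕ → ℂ}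
    (h : HasFPowerSeriesAt f (FormalMultilinearSeries.ofScalars ℂ c) 0) (n : ℕ) :
    taylorCoeff f n = c n :=
  (congrFun (FormalMultilinearSeries.ofScalars_series_injective ℂ ℂ
    (h.eq_formalMultilinearSeries h.analyticAt.hasFPowerSeriesAt)) n).symm

theorem taylorCoeff_eq_of_hasSum {f : ℂ → ℂ} {c : ℕ → ℂ}
    (h : ∀ z ∈ Metric.ball (0 : ℂ) 1, HasSum (fun n => c n * z ^ n) (f z)) (n : ℕ) :
    taylorCoeff f n = c n := by
  refine taylorCoeff_eq_of_hasFPowerSeriesAt (hasFPowerSeriesAt_iff.2 ?_) n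
  filter_upwards [Metric.ball_mem_nhds (0 : ℂ) one_pos] with z hz
  simpa [FormalMultilinearSeries.coeff_ofScalars, mul_comm] using h z hz

theorem hasSum_taylorCoeff {f : ℂ → ℂ} (hf : DifferentiableOn ℂ f (Metric.ball 0 1)) {z : ℂ}
    (hz : z ∈ Metric.ball (0 : ℂ) 1) : HasSum (fun n => taylorCoeff f n * z ^ n) (f z) := by
  have := Complex.hasSum_taylorSeries_on_ball hf hz
  have e : (fun n => taylorCoeff f n * z ^ n) =
      fun n : ℕ => (n.factorial : ℂ)⁻¹ • (z - 0) ^ n • iteratedDeriv n f 0 := by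
    ext n
    simp only [taylorCoeff, smul_eq_mul, sub_zero]
    ring
  rwa [e]

theorem taylorCoeff_deriv (f : ℂ → ℂ) (n : ℕ) :
    taylorCoeff (deriv f) n = (n + 1) * taylorCoeff f (n + 1) := by
  have h : ((n : ℂ) + 1) ≠ 0 := by exact_mod_cast n.succ_ne_zero
  have h2 : (n.factorial : ℂ) ≠ 0 := by exact_mod_cast n.factorial_ne_zero
  rw [taylorCoeff, taylorCoeff, iteratedDeriv_succ', Nat.factorial_succ]
  push_cast
  field_simp

theorem taylorCoeff_congr {f g : ℂ → ℂ} (h : EqOn f g (Metric.ball 0 1)) (n : ℕ) :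
    taylorCoeff f n = taylorCoeff g n := by
  have : f =ᶠ[𝓝 0] g := h.eventuallyEq_of_mem (Metric.ball_mem_nhds 0 one_pos)
  rw [taylorCoeff, taylorCoeff, this.iteratedDeriv_eq]

theorem summable_norm_taylorCoeff {f : ℂ → ℂ} (hf : DifferentiableOn ℂ f (Metric.ball 0 1))
    {r : ℝ} (hr : r ∈ Ico (0 : ℝ) 1) : Summable (fun n => ‖taylorCoeff f n‖ * r ^ n) := by
  have hz : (r : ℂ) ∈ Metric.ball (0 : ℂ) 1 := by simpa [abs_of_nonneg hr.1] using hr.2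
  have := (hasSum_taylorCoeff hf hz).summable.norm
  simpa [abs_of_nonneg hr.1] using this

theorem taylorCoeff_mul {f g : ℂ → ℂ} (hf : DifferentiableOn ℂ f (Metric.ball 0 1))
    (hg : DifferentiableOn ℂ g (Metric.ball 0 1)) (n : ℕ) :
    taylorCoeff (fun z => f z * g z) n =
      ∑ p ∈ Finset.HasAntidiagonal.antidiagonal n, taylorCoeff f p.1 * taylorCoeff g p.2 := by
  refine taylorCoeff_eq_of_hasSum
    (c := fun n => ∑ p ∈ Finset.HasAntidiagonal.antidiagonal n, taylorCoeff f p.1 * taylorCoeff g p.2)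
    (fun z hz => ?_) n
  have h1 := hasSum_taylorCoeff hf hz
  have h2 := hasSum_taylorCoeff hg hz
  have h3 := (summable_norm_sum_mul_antidiagonal_of_summable_norm h1.summable.norm
    h2.summable.norm).of_norm.hasSum
  rw [← tsum_mul_tsum_eq_tsum_sum_antidiagonal_of_summable_norm h1.summable.norm
    h2.summable.norm, h1.tsum_eq, h2.tsum_eq] at h3
  refine h3.congr_fun fun n => ?_
  rw [Finset.sum_mul]
  refine Finset.sum_congr rfl fun p hp => ?_
  rw [← Finset.HasAntidiagonal.mem_antidiagonal.1 hp, pow_add]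
  ring

theorem differentiableOn_tsum_mul_pow {c : ℕ → ℂ}
    (hc : ∀ r ∈ Ico (0 : ℝ) 1, Summable (fun n => ‖c n‖ * r ^ n)) :
    DifferentiableOn ℂ (fun z => ∑' n, c n * z ^ n) (Metric.ball 0 1) := by
  intro z hz
  obtain ⟨r, hzr, hr1⟩ := exists_between (mem_ball_zero_iff.1 hz)
  have hr0 : 0 ≤ r := (norm_nonneg z).trans hzr.le
  have h : DifferentiableOn ℂ (fun z => ∑' n, c n * z ^ n) (Metric.ball 0 r) := by
    refine Complex.differentiableOn_tsum_of_summable_norm (hc r ⟨hr0, hr1⟩)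
      (fun n => by fun_prop) Metric.isOpen_ball fun n w hw => ?_
    rw [norm_mul, norm_pow]
    have := mem_ball_zero_iff.1 hw
    gcongr
  exact (h.differentiableAt (Metric.isOpen_ball.mem_nhds
    (mem_ball_zero_iff.2 hzr))).differentiableWithinAt

theorem taylorCoeff_tsum_mul_pow {c : ℕ → ℂ}
    (hc : ∀ r ∈ Ico (0 : ℝ) 1, Summable (fun n => ‖c n‖ * r ^ n)) (n : ℕ) :
    taylorCoeff (fun z => ∑' n, c n * z ^ n) n = c n := by
  refine taylorCoeff_eq_of_hasSum (fun z hz => ?_) n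
  refine (Summable.of_norm ?_).hasSum
  simpa using hc ‖z‖ ⟨norm_nonneg z, mem_ball_zero_iff.1 hz⟩

/-- Termwise differentiation of a real power series; it is read off from the complex one. -/
theorem hasDerivAt_tsum_mul_pow {a : ℕ → ℝ} (ha0 : ∀ n, 0 ≤ a n)
    (ha : ∀ r ∈ Ico (0 : ℝ) 1, Summable (fun n => a n * r ^ n)) {x : ℝ} (hx : x ∈ Ico (0 : ℝ) 1) :
    Summable (fun n : ℕ => ((n + 1 : ℕ) * a (n + 1)) * x ^ n) ∧
    HasDerivAt (fun y => ∑' n, a n * y ^ n) (∑' n : ℕ, ((n + 1 : ℕ) * a (n + 1)) * x ^ n) x := by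
  set c : ℕ → ℂ := fun n => (a n : ℂ) with hcdef
  have hc : ∀ r ∈ Ico (0 : ℝ) 1, Summable (fun n => ‖c n‖ * r ^ n) := by
    intro r hr
    simpa [c, abs_of_nonneg (ha0 _)] using ha r hr
  have hd := differentiableOn_tsum_mul_pow hc
  have hxm : (x : ℂ) ∈ Metric.ball (0 : ℂ) 1 := by simpa [abs_of_nonneg hx.1] using hx.2
  have hd' := hd.deriv Metric.isOpen_ball
  have h1 := (hd.differentiableAt (Metric.isOpen_ball.mem_nhds hxm)).hasDerivAt
  have h2 := hasSum_taylorCoeff hd' hxm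
  simp only [taylorCoeff_deriv, taylorCoeff_tsum_mul_pow hc] at h2
  have h3 : HasSum (fun n : ℕ => ((((n + 1 : ℕ) * a (n + 1)) * x ^ n : ℝ) : ℂ))
      (deriv (fun z : ℂ => ∑' n, c n * z ^ n) x) := by
    convert h2 using 2 with n
    simp [c]
  have h4 := Complex.hasSum_re h3
  simp only [Complex.ofReal_re] at h4
  refine ⟨h4.summable, ?_⟩
  rw [h4.tsum_eq]
  convert h1.real_of_complex using 2 with y
  have : (∑' n, c n * (y : ℂ) ^ n) = ((∑' n, a n * y ^ n : ℝ) : ℂ) := by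
    rw [Complex.ofReal_tsum]
    simp [c]
  rw [this, Complex.ofReal_re]

/-- **Parseval's identity** for power series that converge absolutely on the unit circle. -/
theorem circleAverage_norm_sq_tsum {c : ℕ → ℂ} (hc : Summable (fun n => ‖c n‖)) :
    Real.circleAverage (fun z => ‖∑' n, c n * z ^ n‖ ^ 2) 0 1 = ∑' n, ‖c n‖ ^ 2 := by
  have hsq : Summable (fun n => ‖c n‖ ^ 2) := by
    refine Summable.of_norm_bounded_eventually_nat hc ?_
    filter_upwards [hc.tendsto_atTop_zero.eventually_le_const one_pos] with n hn
    rw [Real.norm_of_nonneg (by positivity)]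
    nlinarith [norm_nonneg (c n)]
  let p : ℕ → Polynomial ℂ := fun N => ∑ i ∈ Finset.range N, Polynomial.C (c i) * Polynomial.X ^ i
  have hp : ∀ N, Real.circleAverage (fun z => ‖∑ i ∈ Finset.range N, c i * z ^ i‖ ^ 2) 0 1 =
      ∑ i ∈ Finset.range N, ‖c i‖ ^ 2 := by
    intro N
    have hcoeff : ∀ i, (p N).coeff i = if i < N then c i else 0 := by
      intro i
      simp [p, Polynomial.coeff_C_mul, Polynomial.coeff_X_pow]
    have h1 := (p N).sum_sq_norm_coeff_eq_circleAverage
    have h2 : ∑ i ∈ (p N).support, ‖(p N).coeff i‖ ^ 2 = ∑ i ∈ Finset.range N, ‖c i‖ ^ 2 := by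
      rw [Finset.sum_subset (s₂ := Finset.range N)]
      · refine Finset.sum_congr rfl fun i hi => ?_
        rw [hcoeff, if_pos (Finset.mem_range.1 hi)]
      · intro i hi
        rw [Polynomial.mem_support_iff, hcoeff] at hi
        rw [Finset.mem_range]
        by_contra h
        simp [h] at hi
      · intro i _ hi
        simp [Polynomial.notMem_support_iff.1 hi]
    rw [← h2, h1]
    simp [p, Polynomial.eval_finsetSum]
  have hlim : Tendsto (fun N => Real.circleAverage
      (fun z => ‖∑ i ∈ Finset.range N, c i * z ^ i‖ ^ 2) 0 1) atTop
      (𝓝 (Real.circleAverage (fun z => ‖∑' n, c n * z ^ n‖ ^ 2) 0 1)) := by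
    simp only [Real.circleAverage_def]
    refine Tendsto.const_smul ?_ _
    have hn : ∀ θ : ℝ, ‖circleMap 0 1 θ‖ = 1 := by simp
    refine intervalIntegral.tendsto_integral_filter_of_dominated_convergence
      (fun _ => (∑' n, ‖c n‖) ^ 2) ?_ ?_ ?_ ?_
    · refine Eventually.of_forall fun N => Continuous.aestronglyMeasurable ?_
      have := continuous_circleMap 0 1
      fun_prop
    · refine Eventually.of_forall fun N => Eventually.of_forall fun θ _ => ?_
      rw [Real.norm_of_nonneg (by positivity)]
      gcongr
      refine (norm_sum_le _ _).trans ?_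
      simp only [norm_mul, norm_pow, hn, one_pow, mul_one]
      exact hc.sum_le_tsum _ fun _ _ => norm_nonneg _
    · simp
    · refine Eventually.of_forall fun θ _ => ?_
      refine Tendsto.pow (Tendsto.norm ?_) 2
      refine HasSum.tendsto_sum_nat (Summable.hasSum (Summable.of_norm ?_))
      simpa only [norm_mul, norm_pow, hn, one_pow, mul_one] using hc
  simp only [hp] at hlim
  exact tendsto_nhds_unique hlim hsq.hasSum.tendsto_sum_nat

theorem summable_norm_sq_taylorCoeff {f : ℂ → ℂ} (hf : DifferentiableOn ℂ f (Metric.ball 0 1))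
    {x : ℝ} (hx : x ∈ Ico (0 : ℝ) 1) : Summable (fun n => ‖taylorCoeff f n‖ ^ 2 * x ^ n) := by
  have hr : √x ∈ Ico (0 : ℝ) 1 := ⟨Real.sqrt_nonneg x, by
    rw [Real.sqrt_lt' one_pos]; simpa using hx.2⟩
  have hs := summable_norm_taylorCoeff hf hr
  refine Summable.of_norm_bounded_eventually_nat hs ?_
  filter_upwards [hs.tendsto_atTop_zero.eventually_le_const one_pos] with n hn
  have h0 : 0 ≤ ‖taylorCoeff f n‖ * √x ^ n := by positivity
  have h1 : ‖taylorCoeff f n‖ ^ 2 * x ^ n = (‖taylorCoeff f n‖ * √x ^ n) ^ 2 := by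
    rw [mul_pow, ← pow_mul, mul_comm n, pow_mul, Real.sq_sqrt hx.1]
  rw [h1, Real.norm_of_nonneg (by positivity)]
  nlinarith

theorem circleAverage_norm_sq {f : ℂ → ℂ} (hf : DifferentiableOn ℂ f (Metric.ball 0 1)) {r : ℝ}
    (hr : r ∈ Ico (0 : ℝ) 1) :
    Real.circleAverage (fun z => ‖f z‖ ^ 2) 0 r = ∑' n, ‖taylorCoeff f n‖ ^ 2 * (r ^ 2) ^ n := by
  have hs := summable_norm_taylorCoeff hf hr
  have h := circleAverage_norm_sq_tsum (c := fun n => taylorCoeff f n * (r : ℂ) ^ n)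
    (by simpa [abs_of_nonneg hr.1] using hs)
  convert h using 1
  · simp only [Real.circleAverage_def]
    congr 2
    ext θ
    have h1 : circleMap 0 r θ = r * circleMap 0 1 θ := by simp [circleMap]
    have h2 : circleMap 0 r θ ∈ Metric.ball (0 : ℂ) 1 := by
      simpa [abs_of_nonneg hr.1] using hr.2
    rw [← (hasSum_taylorCoeff hf h2).tsum_eq, h1]
    simp only [mul_pow, mul_assoc]
  · congr 1
    ext n
    simp [mul_pow, ← pow_mul, mul_comm 2 n, abs_of_nonneg hr.1]

/-- A pointwise bound between two analytic functions on a circle carries over to the sums of the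
squares of their coefficients. -/
theorem tsum_norm_sq_le {f g : ℂ → ℂ} (hf : DifferentiableOn ℂ f (Metric.ball 0 1))
    (hg : DifferentiableOn ℂ g (Metric.ball 0 1)) {r M : ℝ} (hr : r ∈ Ico (0 : ℝ) 1)
    (h : ∀ z : ℂ, ‖z‖ = r → ‖f z‖ ≤ M * ‖g z‖) :
    ∑' n, ‖taylorCoeff f n‖ ^ 2 * (r ^ 2) ^ n ≤
      M ^ 2 * ∑' n, ‖taylorCoeff g n‖ ^ 2 * (r ^ 2) ^ n := by
  rw [← circleAverage_norm_sq hf hr, ← circleAverage_norm_sq hg hr, ← smul_eq_mul (M ^ 2),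
    ← Real.circleAverage_fun_smul]
  have hsub : Metric.sphere (0 : ℂ) |r| ⊆ Metric.ball 0 1 := fun z hz => by
    have : ‖z‖ = r := by simpa [abs_of_nonneg hr.1] using hz
    simpa [this] using hr.2
  have hfc := hf.continuousOn.mono hsub
  have hgc := hg.continuousOn.mono hsub
  refine Real.circleAverage_mono (ContinuousOn.circleIntegrable' ?_)
    (ContinuousOn.circleIntegrable' ?_) fun z hz => ?_
  · fun_prop
  · fun_prop
  · have : ‖z‖ = r := by simpa [abs_of_nonneg hr.1] using hz
    rw [smul_eq_mul, ← mul_pow]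
    exact pow_le_pow_left₀ (norm_nonneg _) (h z this) 2

/-! ### A comparison principle for an ordinary differential inequality -/

/-- A maximum principle: a solution of `(x W')' ≥ q W` with `q ≥ 0` that starts out positive and
increasing stays positive. Here `Z` is `x W'`. -/
theorem pos_of_deriv_mul_deriv_nonneg {W Z Z' : ℝ → ℝ} {a b : ℝ} (ha : 0 < a)
    (hW : ∀ x ∈ Ico a b, HasDerivAt W (Z x / x) x) (hZ : ∀ x ∈ Ico a b, HasDerivAt Z (Z' x) x)
    (hZ' : ∀ x ∈ Ico a b, 0 ≤ W x → 0 ≤ Z' x) (hWa : 0 < W a) (hZa : 0 < Z a) :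
    ∀ x ∈ Ico a b, 0 < W x := by
  intro y hy
  by_contra! hWy
  have hsub : Icc a y ⊆ Ico a b := fun t ht => ⟨ht.1, ht.2.trans_lt hy.2⟩
  have hWc : ContinuousOn W (Icc a y) := fun t ht =>
    (hW t (hsub ht)).continuousAt.continuousWithinAt
  -- the first point where `W` fails to be positive
  set S := Icc a y ∩ W ⁻¹' Iic 0 with hS
  have hScl : IsClosed S := hWc.preimage_isClosed_of_isClosed isClosed_Icc isClosed_Iic
  have hSne : S.Nonempty := ⟨y, ⟨hy.1, le_rfl⟩, hWy⟩
  have hSbd : BddBelow S := ⟨a, fun t ht => ht.1.1⟩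
  set m := sInf S with hm
  obtain ⟨hmI, hmW⟩ : m ∈ S := hScl.csInf_mem hSne hSbd
  have hpos : ∀ t ∈ Ico a m, 0 < W t := by
    intro t ht
    by_contra! h
    exact absurd (csInf_le hSbd ⟨⟨ht.1, ht.2.le.trans hmI.2⟩, h⟩) (not_le.2 ht.2)
  have hsub' : Icc a m ⊆ Ico a b := fun t ht => hsub ⟨ht.1, ht.2.trans hmI.2⟩
  have hZm : MonotoneOn Z (Icc a m) := by
    refine monotoneOn_of_deriv_nonneg (convex_Icc a m)
      (fun t ht => (hZ t (hsub' ht)).continuousAt.continuousWithinAt)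
      (fun t ht => (hZ t (hsub' (interior_subset ht))).differentiableAt.differentiableWithinAt)
      fun t ht => ?_
    rw [interior_Icc] at ht
    have h1 := hsub' (Ioo_subset_Icc_self ht)
    rw [(hZ t h1).deriv]
    exact hZ' t h1 (hpos t ⟨ht.1.le, ht.2⟩).le
  have hWm : MonotoneOn W (Icc a m) := by
    refine monotoneOn_of_deriv_nonneg (convex_Icc a m)
      (fun t ht => (hW t (hsub' ht)).continuousAt.continuousWithinAt)
      (fun t ht => (hW t (hsub' (interior_subset ht))).differentiableAt.differentiableWithinAt)
      fun t ht => ?_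
    have h0 := interior_subset ht
    rw [(hW t (hsub' h0)).deriv]
    exact div_nonneg (hZa.le.trans (hZm ⟨le_rfl, hmI.1⟩ h0 h0.1)) (ha.le.trans h0.1)
  exact absurd (hWm ⟨le_rfl, hmI.1⟩ ⟨hmI.1, le_rfl⟩ hmI.1) (not_le.2 (lt_of_le_of_lt hmW hWa))

/-- A subsolution of `(x u')' = lam² u / (1 - x)²` is `O((1 - x)^(-β))` at `1` for every `β > 0` with
`β (β + 1) > lam²`: near `1`, the function `(1 - x)^(-β)` is a supersolution. Here `P` is `x u'`. -/
theorem exists_le_mul_one_sub_rpow {u P P' : ℝ → ℝ} {lam β : ℝ} (hβ : 0 < β)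
    (hlam : lam ^ 2 < β * (β + 1)) (hu : ∀ x ∈ Ioo (0 : ℝ) 1, HasDerivAt u (P x / x) x)
    (hP : ∀ x ∈ Ioo (0 : ℝ) 1, HasDerivAt P (P' x) x)
    (hP' : ∀ x ∈ Ioo (0 : ℝ) 1, P' x ≤ lam ^ 2 / (1 - x) ^ 2 * u x) :
    ∃ C, ∃ a < 1, ∀ x ∈ Ico a 1, u x ≤ C * (1 - x) ^ (-β) := by
  obtain ⟨a, hlo, ha1⟩ := exists_between ((div_lt_one (by positivity)).2 hlam)
  have ha0 : 0 < a := lt_of_le_of_lt (by positivity) hlo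
  rw [div_lt_iff₀ (by positivity)] at hlo
  have hpos1 : 0 < (1 - a) ^ (-β) := Real.rpow_pos_of_pos (by linarith) _
  have hpos2 : 0 < a * (β * (1 - a) ^ (-β - 1)) :=
    mul_pos ha0 (mul_pos hβ (Real.rpow_pos_of_pos (by linarith) _))
  obtain ⟨C, hC0, hC1, hC2⟩ : ∃ C, 0 ≤ C ∧ u a < C * (1 - a) ^ (-β) ∧
      P a < C * (a * (β * (1 - a) ^ (-β - 1))) := by
    refine ⟨max 0 (max (u a / (1 - a) ^ (-β)) (P a / (a * (β * (1 - a) ^ (-β - 1))))) + 1,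
      by positivity, ?_, ?_⟩
    · rw [← div_lt_iff₀ hpos1]
      exact lt_of_le_of_lt ((le_max_left _ _).trans (le_max_right _ _)) (lt_add_one _)
    · rw [← div_lt_iff₀ hpos2]
      exact lt_of_le_of_lt ((le_max_right _ _).trans (le_max_right _ _)) (lt_add_one _)
  have hv : ∀ p : ℝ, ∀ x ∈ Ico a 1, HasDerivAt (fun x => (1 - x) ^ p) (-p * (1 - x) ^ (p - 1)) x := by
    intro p x hx
    have h1 : HasDerivAt (fun x : ℝ => 1 - x) (-1) x := by
      simpa using (hasDerivAt_id x).const_sub 1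
    convert h1.rpow_const (p := p) (Or.inl (by linarith [hx.2])) using 1
    ring
  refine ⟨C, a, ha1, fun x hx => ?_⟩
  have key := pos_of_deriv_mul_deriv_nonneg (W := fun x => C * (1 - x) ^ (-β) - u x)
    (Z := fun x => C * (x * (β * (1 - x) ^ (-β - 1))) - P x)
    (Z' := fun x => C * (1 * (β * (1 - x) ^ (-β - 1)) +
      x * (β * (-(-β - 1) * (1 - x) ^ (-β - 1 - 1)))) - P' x) (b := 1) ha0 ?_ ?_ ?_
    (sub_pos.2 hC1) (sub_pos.2 hC2) x hx
  · exact (sub_pos.1 key).le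
  · intro x hx
    have hx0 : 0 < x := ha0.trans_le hx.1
    refine (((hv (-β) x hx).const_mul C).sub (hu x ⟨hx0, hx.2⟩)).congr_deriv ?_
    field_simp
  · intro x hx
    have hx0 : 0 < x := ha0.trans_le hx.1
    exact ((((hasDerivAt_id x).mul ((hv (-β - 1) x hx).const_mul β))).const_mul C).sub
      (hP x ⟨hx0, hx.2⟩)
  · intro x hx hW
    have hx0 : 0 < x := ha0.trans_le hx.1
    have h1x : 0 < 1 - x := by linarith [hx.2]
    have hy : 0 < (1 - x) ^ (-β - 2) := Real.rpow_pos_of_pos h1x _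
    have e1 : (1 - x) ^ (-β - 1) = (1 - x) ^ (-β - 2) * (1 - x) := by
      rw [← Real.rpow_add_one h1x.ne']; ring_nf
    have e2 : (1 - x) ^ (-β) = (1 - x) ^ (-β - 2) * (1 - x) ^ 2 := by
      rw [← Real.rpow_natCast, ← Real.rpow_add h1x]; norm_num
    have e3 : (1 - x) ^ (-β - 1 - 1) = (1 - x) ^ (-β - 2) := by ring_nf
    have h2 : P' x ≤ lam ^ 2 / (1 - x) ^ 2 * (C * (1 - x) ^ (-β)) :=
      (hP' x ⟨hx0, hx.2⟩).trans (mul_le_mul_of_nonneg_left (by linarith) (by positivity))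
    have h3 : lam ^ 2 / (1 - x) ^ 2 * (C * (1 - x) ^ (-β)) = C * (1 - x) ^ (-β - 2) * lam ^ 2 := by
      rw [e2]; field_simp
    rw [h3] at h2
    rw [e1, e3]
    have h4 : lam ^ 2 ≤ β * (1 - x) + x * (β * (β + 1)) := by
      have : a * (β * (β + 1)) ≤ x * (β * (β + 1)) := by gcongr; exact hx.1
      nlinarith [mul_pos hβ h1x]
    have h5 := mul_le_mul_of_nonneg_left h4 (mul_nonneg hC0 hy.le)
    linarith

/-! ### Coefficient growth of nonvanishing functions with bounded pre-Schwarzian derivative -/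

theorem exists_sqrt_of_ne_zero {ψ : ℂ → ℂ} (hψ : DifferentiableOn ℂ ψ (Metric.ball 0 1))
    (hne : ∀ z ∈ Metric.ball (0 : ℂ) 1, ψ z ≠ 0) :
    ∃ χ : ℂ → ℂ, DifferentiableOn ℂ χ (Metric.ball 0 1) ∧
      ∀ z ∈ Metric.ball (0 : ℂ) 1, ψ z = χ z * χ z := by
  have h0 : (0 : ℂ) ∈ Metric.ball (0 : ℂ) 1 := by simp
  have hψ' := hψ.deriv Metric.isOpen_ball
  -- a logarithm of `ψ`
  obtain ⟨L, hL0, hL⟩ := ((hψ'.div hψ hne).isExactOn_ball).with_val_at 0 (Complex.log (ψ 0))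
  have hconst : ∀ z ∈ Metric.ball (0 : ℂ) 1, HasDerivAt (fun z => ψ z * Complex.exp (-L z)) 0 z := by
    intro z hz
    have h1 := (hψ.differentiableAt (Metric.isOpen_ball.mem_nhds hz)).hasDerivAt
    refine (h1.mul (hL z hz).neg.cexp).congr_deriv ?_
    have := hne z hz
    simp only [Pi.div_apply]
    field_simp
    ring
  have hexp : ∀ z ∈ Metric.ball (0 : ℂ) 1, ψ z = Complex.exp (L z) := by
    intro z hz
    have h1 : ψ z * Complex.exp (-L z) = ψ 0 * Complex.exp (-L 0) := by
      refine (convex_ball (0 : ℂ) 1).is_const_of_fderivWithin_eq_zero (𝕜 := ℂ)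
        (f := fun z => ψ z * Complex.exp (-L z))
        (fun w hw => (hconst w hw).differentiableAt.differentiableWithinAt) (fun w hw => ?_) hz h0
      rw [fderivWithin_of_isOpen Metric.isOpen_ball hw]
      ext
      simpa using (hconst w hw).deriv
    rw [hL0, Complex.exp_neg, Complex.exp_neg, Complex.exp_log (hne 0 h0),
      mul_inv_cancel₀ (hne 0 h0)] at h1
    exact eq_of_mul_inv_eq_one h1
  refine ⟨fun z => Complex.exp (L z / 2), fun z hz => ?_, fun z hz => ?_⟩
  · exact ((hL z hz).div_const 2).cexp.differentiableAt.differentiableWithinAt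
  · rw [hexp z hz, ← Complex.exp_add, add_halves]

/-- The coefficients of `χ²` are controlled by the mean square of `χ` on a circle. -/
theorem norm_taylorCoeff_sq_le {χ : ℂ → ℂ} (hχ : DifferentiableOn ℂ χ (Metric.ball 0 1)) {r : ℝ}
    (hr : r ∈ Ico (0 : ℝ) 1) (n : ℕ) :
    ‖taylorCoeff (fun z => χ z * χ z) n‖ * r ^ n ≤
      ∑' n, ‖taylorCoeff χ n‖ ^ 2 * (r ^ 2) ^ n := by
  set a : ℕ → ℝ := fun n => ‖taylorCoeff χ n‖ * r ^ n with ha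
  have ha2 : ∀ n, a n ^ 2 = ‖taylorCoeff χ n‖ ^ 2 * (r ^ 2) ^ n := fun n => by
    simp only [a]; ring
  have hs := summable_norm_sq_taylorCoeff hχ (x := r ^ 2)
    ⟨by positivity, by nlinarith [hr.1, hr.2]⟩
  simp only [← ha2] at hs ⊢
  have hfst : ∑ p ∈ Finset.HasAntidiagonal.antidiagonal n, a p.1 ^ 2 ≤ ∑' n, a n ^ 2 := by
    rw [Finset.Nat.sum_antidiagonal_eq_sum_range_succ (fun i _ => a i ^ 2)]
    exact hs.sum_le_tsum _ fun _ _ => sq_nonneg _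
  have hsnd : ∑ p ∈ Finset.HasAntidiagonal.antidiagonal n, a p.2 ^ 2 ≤ ∑' n, a n ^ 2 := by
    rw [Finset.Nat.sum_antidiagonal_swap (f := fun p => a p.2 ^ 2) |>.symm]
    exact hfst
  calc ‖taylorCoeff (fun z => χ z * χ z) n‖ * r ^ n
      ≤ (∑ p ∈ Finset.HasAntidiagonal.antidiagonal n,
          ‖taylorCoeff χ p.1 * taylorCoeff χ p.2‖) * r ^ n := by
        rw [taylorCoeff_mul hχ hχ]
        exact mul_le_mul_of_nonneg_right (norm_sum_le _ _) (pow_nonneg hr.1 n)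
    _ = ∑ p ∈ Finset.HasAntidiagonal.antidiagonal n, a p.1 * a p.2 := by
        rw [Finset.sum_mul]
        refine Finset.sum_congr rfl fun p hp => ?_
        rw [← Finset.HasAntidiagonal.mem_antidiagonal.1 hp, pow_add, norm_mul]
        simp only [a]
        ring
    _ ≤ ∑ p ∈ Finset.HasAntidiagonal.antidiagonal n, (a p.1 ^ 2 + a p.2 ^ 2) / 2 :=
        Finset.sum_le_sum fun p _ => by nlinarith [sq_nonneg (a p.1 - a p.2)]
    _ ≤ ∑' n, a n ^ 2 := by
        rw [← Finset.sum_div, Finset.sum_add_distrib]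
        linarith

/-- If `(1 - |z|²) |χ'| ≤ lam |χ|`, then the mean square of `χ` on the circle `|z|² = x` is
`O((1 - x)^(-β))`. -/
theorem exists_tsum_norm_sq_le {χ : ℂ → ℂ} (hχ : DifferentiableOn ℂ χ (Metric.ball 0 1))
    {lam β : ℝ} (hβ : 0 < β) (hlam : lam ^ 2 < β * (β + 1))
    (hb : ∀ z ∈ Metric.ball (0 : ℂ) 1, (1 - ‖z‖ ^ 2) * ‖deriv χ z‖ ≤ lam * ‖χ z‖) :
    ∃ C, ∃ a < 1, ∀ x ∈ Ico a 1, ∑' n, ‖taylorCoeff χ n‖ ^ 2 * x ^ n ≤ C * (1 - x) ^ (-β) := by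
  set e : ℕ → ℝ := fun n => ‖taylorCoeff χ n‖ ^ 2 with he
  have he0 : ∀ n, 0 ≤ e n := fun n => sq_nonneg _
  have hs : ∀ r ∈ Ico (0 : ℝ) 1, Summable (fun n => e n * r ^ n) := fun r hr =>
    summable_norm_sq_taylorCoeff hχ hr
  have hs1 : ∀ r ∈ Ico (0 : ℝ) 1, HasSum (fun n : ℕ => (n * e n) * r ^ n)
      (r * ∑' n : ℕ, ((n + 1 : ℕ) * e (n + 1)) * r ^ n) := by
    intro r hr
    have h1 := (hasDerivAt_tsum_mul_pow he0 hs hr).1.hasSum.mul_left r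
    rw [← hasSum_nat_add_iff' 1]
    simp only [Finset.sum_range_one, Nat.cast_zero, zero_mul, sub_zero]
    refine h1.congr_fun fun n => ?_
    rw [pow_succ]
    ring
  refine exists_le_mul_one_sub_rpow (P := fun x => ∑' n : ℕ, (n * e n) * x ^ n)
    (P' := fun x => ∑' n : ℕ, ((n + 1 : ℕ) * ((n + 1 : ℕ) * e (n + 1))) * x ^ n) hβ hlam
    (fun x hx => ?_) (fun x hx => ?_) (fun x hx => ?_)
  · refine (hasDerivAt_tsum_mul_pow he0 hs ⟨hx.1.le, hx.2⟩).2.congr_deriv ?_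
    rw [(hs1 x ⟨hx.1.le, hx.2⟩).tsum_eq, mul_div_cancel_left₀ _ hx.1.ne']
  · exact (hasDerivAt_tsum_mul_pow (fun n => mul_nonneg n.cast_nonneg (he0 n))
      (fun r hr => (hs1 r hr).summable) ⟨hx.1.le, hx.2⟩).2
  · have hr : √x ∈ Ico (0 : ℝ) 1 := ⟨Real.sqrt_nonneg x, by
      rw [Real.sqrt_lt' one_pos]; simpa using hx.2⟩
    have h1x : 0 < 1 - x := by linarith [hx.2]
    have h := tsum_norm_sq_le (hχ.deriv Metric.isOpen_ball) hχ hr (M := lam / (1 - x)) ?_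
    · rw [Real.sq_sqrt hx.1.le, div_pow] at h
      convert h using 4 with n
      rw [taylorCoeff_deriv, norm_mul, mul_pow, ← Nat.cast_add_one, Complex.norm_natCast]
      simp only [e]
      ring
    · intro z hz
      have hz2 : ‖z‖ ^ 2 = x := by rw [hz, Real.sq_sqrt hx.1.le]
      have := hb z (mem_ball_zero_iff.2 (hz ▸ hr.2))
      rw [hz2] at this
      rw [div_mul_eq_mul_div, le_div_iff₀ h1x]
      linarith

/-- Coefficient growth of a nonvanishing analytic function `ψ` with `(1 - |z|²) |ψ'/ψ| ≤ 2 lam`. -/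
theorem taylorCoeff_isBigO {ψ : ℂ → ℂ} (hψ : DifferentiableOn ℂ ψ (Metric.ball 0 1))
    (hne : ∀ z ∈ Metric.ball (0 : ℂ) 1, ψ z ≠ 0) {lam β : ℝ} (hβ : 0 < β)
    (hlam : lam ^ 2 < β * (β + 1))
    (hb : ∀ z ∈ Metric.ball (0 : ℂ) 1, (1 - ‖z‖ ^ 2) * ‖deriv ψ z‖ ≤ 2 * lam * ‖ψ z‖) :
    (fun n => taylorCoeff ψ n) =O[atTop] (fun n : ℕ => (n : ℝ) ^ β) := by
  obtain ⟨χ, hχ, hψχ⟩ := exists_sqrt_of_ne_zero hψ hne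
  have hbχ : ∀ z ∈ Metric.ball (0 : ℂ) 1, (1 - ‖z‖ ^ 2) * ‖deriv χ z‖ ≤ lam * ‖χ z‖ := by
    intro z hz
    have hnz : 0 < ‖χ z‖ := norm_pos_iff.2 fun h => hne z hz (by rw [hψχ z hz, h, mul_zero])
    have h1 := (hχ.differentiableAt (Metric.isOpen_ball.mem_nhds hz)).hasDerivAt
    have h2 : ψ =ᶠ[𝓝 z] fun z => χ z * χ z :=
      EqOn.eventuallyEq_of_mem hψχ (Metric.isOpen_ball.mem_nhds hz)
    have h3 : deriv ψ z = 2 * (deriv χ z * χ z) := by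
      rw [h2.deriv_eq]
      refine (h1.mul h1).deriv.trans ?_
      ring
    have h4 := hb z hz
    rw [h3, hψχ z hz, norm_mul, norm_mul, norm_mul, Complex.norm_ofNat] at h4
    refine le_of_mul_le_mul_right ?_ hnz
    linarith
  obtain ⟨C, a, ha1, hC⟩ := exists_tsum_norm_sq_le hχ hβ hlam hbχ
  refine Asymptotics.IsBigO.of_bound (2 * (max C 0 * 2 ^ β)) ?_
  have hlarge : ∀ᶠ n : ℕ in atTop, 1 / (n : ℝ) < 1 - a :=
    tendsto_one_div_atTop_nhds_zero_nat.eventually_lt_const (by linarith)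
  filter_upwards [hlarge, eventually_ge_atTop 1] with n hn hn1
  have hn0 : (1 : ℝ) ≤ n := by exact_mod_cast hn1
  have hnpos : (0 : ℝ) < n := by linarith
  -- with `r = 1 - 1 / (2 n)`, both `r ^ n` and `n (1 - r²)` are bounded below
  set t : ℝ := 1 / (2 * n) with ht
  have ht0 : 0 < t := by positivity
  have htn : n * t = 1 / 2 := by rw [ht]; field_simp
  have ht1 : t ≤ 1 / 2 := by nlinarith
  have ht2 : 2 * t = 1 / n := by rw [ht]; field_simp
  have hr : 1 - t ∈ Ico (0 : ℝ) 1 := ⟨by linarith, by linarith⟩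
  have hbern : 1 / 2 ≤ (1 - t) ^ n := by
    have := one_add_mul_le_pow (a := -t) (by linarith) n
    rw [← sub_eq_add_neg] at this
    linarith
  have h1 := norm_taylorCoeff_sq_le hχ hr n
  rw [← taylorCoeff_congr (f := ψ) hψχ] at h1
  have hx : (1 - t) ^ 2 ∈ Ico a 1 := ⟨by nlinarith, by nlinarith⟩
  have h2 := hC _ hx
  have hx0 : 0 < 1 - (1 - t) ^ 2 := by nlinarith
  have h3 : (1 - (1 - t) ^ 2) ^ (-β) ≤ 2 ^ β * n ^ β := by
    have h4 : t ^ (-β) = 2 ^ β * n ^ β := by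
      rw [Real.rpow_neg ht0.le, ← Real.inv_rpow ht0.le, ht, one_div, inv_inv,
        Real.mul_rpow (by norm_num) hnpos.le]
    rw [← h4]
    exact Real.rpow_le_rpow_of_nonpos ht0 (by nlinarith) (by linarith)
  have h5 : C * (1 - (1 - t) ^ 2) ^ (-β) ≤ max C 0 * (2 ^ β * n ^ β) :=
    mul_le_mul (le_max_left _ _) h3 (Real.rpow_nonneg hx0.le _) (le_max_right _ _)
  have h6 : ‖taylorCoeff ψ n‖ * (1 / 2) ≤ ‖taylorCoeff ψ n‖ * (1 - t) ^ n := by gcongr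
  rw [Real.norm_of_nonneg (by positivity)]
  linarith

/-! ### The upper bound for the class -/

theorem preSchwarzianNorm_le_iff {h g : ℂ → ℂ} {lam : ℝ} (hlam : 0 < lam) :
    preSchwarzianNorm h g ≤ ENNReal.ofReal (2 * lam) ↔
      ∀ z ∈ Metric.ball (0 : ℂ) 1, ∀ θ ∈ Icc (0 : ℝ) (2 * Real.pi), (1 - ‖z‖ ^ 2) *
      ‖(deriv (deriv h) z + Complex.exp (Complex.I * θ) * deriv (deriv g) z) /
        (deriv h z + Complex.exp (Complex.I * θ) * deriv g z)‖ ≤ 2 * lam := by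
  simp only [preSchwarzianNorm, iSup_le_iff,
    ENNReal.ofReal_le_ofReal_iff (show 0 ≤ 2 * lam by positivity)]

theorem alpha_pos {lam : ℝ} (hlam : 0 < lam) : 0 < alpha lam := by
  have : 1 < √(1 + 4 * lam ^ 2) := by
    rw [Real.lt_sqrt (by norm_num)]
    nlinarith [pow_pos hlam 2]
  unfold alpha
  linarith

theorem alpha_mul_alpha_add_one (lam : ℝ) : alpha lam * (alpha lam + 1) = lam ^ 2 := by
  have := Real.sq_sqrt (show 0 ≤ 1 + 4 * lam ^ 2 by positivity)
  unfold alpha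
  linear_combination this / 4

theorem alpha_le_sq (lam : ℝ) : alpha lam ≤ lam ^ 2 := by
  have : √(1 + 4 * lam ^ 2) ≤ 1 + 2 * lam ^ 2 :=
    Real.sqrt_le_iff.2 ⟨by positivity, by nlinarith [sq_nonneg (lam ^ 2)]⟩
  unfold alpha
  linarith

theorem taylorCoeff_add_const_mul {f g : ℂ → ℂ} (hf : DifferentiableOn ℂ f (Metric.ball 0 1))
    (hg : DifferentiableOn ℂ g (Metric.ball 0 1)) (c : ℂ) (n : ℕ) :
    taylorCoeff (fun z => f z + c * g z) n = taylorCoeff f n + c * taylorCoeff g n := by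
  refine taylorCoeff_eq_of_hasSum (c := fun n => taylorCoeff f n + c * taylorCoeff g n)
    (fun z hz => ?_) n
  refine ((hasSum_taylorCoeff hf hz).add ((hasSum_taylorCoeff hg hz).mul_left c)).congr_fun
    fun n => ?_
  ring

theorem growthExponent_le {f : ℂ → ℂ} {lam β : ℝ} (hlam : 0 < lam) (hf : f ∈ classBH lam)
    (hβ : alpha lam < β) : growthExponent f ≤ (β : EReal) := by
  obtain ⟨-, h, g, hfhg, hne, hnorm⟩ := hf
  rw [preSchwarzianNorm_le_iff hlam] at hnorm
  have hβ0 : 0 < β := (alpha_pos hlam).trans hβ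
  have hβ2 : lam ^ 2 < β * (β + 1) := by
    rw [← alpha_mul_alpha_add_one]
    have := alpha_pos hlam
    gcongr
  have hh' := hfhg.1.deriv Metric.isOpen_ball
  have hg' := hfhg.2.1.deriv Metric.isOpen_ball
  have hθ : ∀ θ ∈ Icc (0 : ℝ) (2 * Real.pi),
      (fun n => taylorCoeff (deriv h) n + Complex.exp (Complex.I * θ) * taylorCoeff (deriv g) n)
        =O[atTop] (fun n : ℕ => (n : ℝ) ^ β) := by
    intro θ hθ
    set c := Complex.exp (Complex.I * θ) with hc
    have := taylorCoeff_isBigO (ψ := fun z => deriv h z + c * deriv g z) (lam := lam)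
      (hh'.add (hg'.const_mul c)) (fun z hz => hne z hz θ hθ) hβ0 hβ2 fun z hz => ?_
    · simpa only [taylorCoeff_add_const_mul hh' hg'] using this
    · have hb := hnorm z hz θ hθ
      have hz' := Metric.isOpen_ball.mem_nhds hz
      have e : deriv (fun z => deriv h z + c * deriv g z) z =
          deriv (deriv h) z + c * deriv (deriv g) z :=
        ((hh'.differentiableAt hz').hasDerivAt.add
          ((hg'.differentiableAt hz').hasDerivAt.const_mul c)).deriv
      rw [norm_div, mul_div_assoc', div_le_iff₀ (norm_pos_iff.2 (hne z hz θ hθ))] at hb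
      rw [e]
      exact hb
  -- `θ = 0` and `θ = π` separate the coefficients of `h` and `g`
  have h0 := hθ 0 ⟨le_rfl, by positivity⟩
  have hπ := hθ Real.pi ⟨Real.pi_pos.le, by linarith [Real.pi_pos]⟩
  rw [mul_comm, Complex.exp_pi_mul_I] at hπ
  simp only [Complex.ofReal_zero, mul_zero, Complex.exp_zero, one_mul] at h0
  have hH : (fun n => taylorCoeff (deriv h) n) =O[atTop] (fun n : ℕ => (n : ℝ) ^ β) := by
    refine ((h0.add hπ).const_mul_left (1 / 2)).congr_left fun n => ?_
    ring
  have hG : (fun n => taylorCoeff (deriv g) n) =O[atTop] (fun n : ℕ => (n : ℝ) ^ β) := by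
    refine ((h0.sub hπ).const_mul_left (1 / 2)).congr_left fun n => ?_
    ring
  refine sInf_le ⟨β, ⟨h, g, hfhg, ?_⟩, rfl⟩
  have hshift : ∀ k : ℂ → ℂ, (fun n => taylorCoeff (deriv k) n) =O[atTop]
      (fun n : ℕ => (n : ℝ) ^ β) →
      (fun n => ‖taylorCoeff k n‖) =O[atTop] (fun n : ℕ => (n : ℝ) ^ (β - 1)) := by
    intro k hk
    obtain ⟨C, hC0, hC⟩ := hk.exists_pos
    refine Asymptotics.IsBigO.of_bound C ?_
    rw [← map_add_atTop_eq_nat 1, eventually_map]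
    filter_upwards [hC.bound] with n hn
    have hn1 : (0 : ℝ) < (n + 1 : ℕ) := by positivity
    rw [taylorCoeff_deriv, norm_mul, ← Nat.cast_add_one, Complex.norm_natCast,
      Real.norm_of_nonneg (by positivity)] at hn
    rw [norm_norm, Real.norm_of_nonneg (by positivity), Real.rpow_sub_one hn1.ne', mul_div_assoc',
      le_div_iff₀ hn1, mul_comm]
    refine hn.trans ?_
    gcongr
    simp
  exact (hshift h hH).add (hshift g hG)

theorem classGrowthExponent_classBH_le {lam : ℝ} (hlam : 0 < lam) :
    classGrowthExponent (classBH lam) ≤ (alpha lam : EReal) := by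
  refine iSup₂_le fun f hf => ?_
  refine EReal.le_of_forall_lt_iff_le.1 fun β hβ => ?_
  exact growthExponent_le hlam hf (EReal.coe_lt_coe_iff.1 hβ)

/-! ### Uniqueness of the decomposition and lower bounds for the class -/

/-- The canonical decomposition determines `h` up to a constant: a function that is both analytic
and antianalytic has vanishing derivative. -/
theorem IsCanonicalDecomposition.deriv_eqOn {f h g h₁ g₁ : ℂ → ℂ}
    (H : IsCanonicalDecomposition f h g) (H₁ : IsCanonicalDecomposition f h₁ g₁) :
    EqOn (deriv h) (deriv h₁) (Metric.ball 0 1) := by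
  intro z hz
  have hz' := Metric.isOpen_ball.mem_nhds hz
  have hF := (H.1.differentiableAt hz').hasDerivAt.sub (H₁.1.differentiableAt hz').hasDerivAt
  have hG := (H₁.2.1.differentiableAt hz').hasDerivAt.sub (H.2.1.differentiableAt hz').hasDerivAt
  set d := deriv h z - deriv h₁ z with hd
  set e := deriv g₁ z - deriv g z with he
  have hconj : (fun w => h w - h₁ w) =ᶠ[𝓝 z] fun w => conj (g₁ w - g w) := by
    filter_upwards [hz'] with w hw
    have h1 := (H.2.2.2 w hw).symm.trans (H₁.2.2.2 w hw)
    rw [map_sub]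
    linear_combination h1
  -- the derivatives along `v = 1` and along `v = I`
  have key : ∀ v : ℂ, d * v = conj (e * v) := by
    intro v
    have hline : HasDerivAt (fun t : ℝ => z + t * v) v 0 := by
      simpa using ((Complex.ofRealCLM.hasDerivAt (x := (0 : ℝ))).mul_const v).const_add z
    have hzero : z + ((0 : ℝ) : ℂ) * v = z := by simp
    have h1 : HasDerivAt (fun t : ℝ => h (z + t * v) - h₁ (z + t * v)) (d * v) 0 :=
      HasDerivAt.comp (h₂ := fun w => h w - h₁ w) 0 (by rw [hzero]; exact hF) hline
    have h2 : HasDerivAt (fun t : ℝ => g₁ (z + t * v) - g (z + t * v)) (e * v) 0 :=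
      HasDerivAt.comp (h₂ := fun w => g₁ w - g w) 0 (by rw [hzero]; exact hG) hline
    have h3 : HasDerivAt (fun t : ℝ => conj (g₁ (z + t * v) - g (z + t * v))) (conj (e * v)) 0 :=
      Complex.conjCLE.toContinuousLinearMap.hasFDerivAt.comp_hasDerivAt (0 : ℝ) h2
    refine h1.unique (h3.congr_of_eventuallyEq ?_)
    have : Tendsto (fun t : ℝ => z + t * v) (𝓝 0) (𝓝 z) := by
      have := hline.continuousAt.tendsto
      rwa [hzero] at this
    exact this.eventually hconj
  have k1 := key 1
  have k2 := key Complex.I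
  rw [map_mul, Complex.conj_I] at k2
  rw [mul_one, mul_one] at k1
  rw [← k1] at k2
  have : d = 0 := by
    have : 2 * Complex.I * d = 0 := by linear_combination k2
    simpa using this
  exact sub_eq_zero.1 this

/-- The analytic map `h` with `h 0 = 0` and `h' = p` lies in `𝓑_H(lam)` if `|p'/p|` is suitably
bounded, so the growth of the coefficients of `p` bounds the exponent of the class from below. -/
theorem le_classGrowthExponent {p : ℂ → ℂ} {lam t : ℝ} (hlam : 0 < lam)
    (hp : DifferentiableOn ℂ p (Metric.ball 0 1)) (hp0 : p 0 = 1)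
    (hne : ∀ z ∈ Metric.ball (0 : ℂ) 1, p z ≠ 0)
    (hb : ∀ z ∈ Metric.ball (0 : ℂ) 1, (1 - ‖z‖ ^ 2) * ‖deriv p z‖ ≤ 2 * lam * ‖p z‖)
    (hgrowth : ∀ s < t, ¬ (fun n => taylorCoeff p n) =O[atTop] (fun n : ℕ => (n : ℝ) ^ s)) :
    (t : EReal) ≤ classGrowthExponent (classBHZero lam) := by
  obtain ⟨h, hh0, hh⟩ := hp.isExactOn_ball.with_val_at 0 0
  have hz0 : (0 : ℂ) ∈ Metric.ball (0 : ℂ) 1 := by simp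
  have hhd : DifferentiableOn ℂ h (Metric.ball 0 1) := fun z hz =>
    (hh z hz).differentiableAt.differentiableWithinAt
  have hderiv : EqOn (deriv h) p (Metric.ball 0 1) := fun z hz => (hh z hz).deriv
  have hcan : IsCanonicalDecomposition h h (fun _ => 0) :=
    ⟨hhd, differentiableOn_const 0, rfl, fun z _ => by simp⟩
  have hmem : h ∈ classBHZero lam := by
    refine ⟨⟨⟨fun z hz => ?_, h, _, hcan, hh0, ?_⟩, h, _, hcan, fun z hz θ _ => ?_, ?_⟩,
      h, _, hcan, by simp⟩
    · exact (hhd.analyticAt (Metric.isOpen_ball.mem_nhds hz)).harmonicAt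
    · rw [hderiv hz0, hp0]
    · simpa [hderiv hz] using hne z hz
    · rw [preSchwarzianNorm_le_iff hlam]
      intro z hz θ _
      have e : deriv (deriv h) z = deriv p z :=
        (hderiv.eventuallyEq_of_mem (Metric.isOpen_ball.mem_nhds hz)).deriv_eq
      have hpos := norm_pos_iff.2 (hne z hz)
      simp only [deriv_const', mul_zero, add_zero, e, hderiv hz, deriv_const]
      rw [norm_div, mul_div_assoc', div_le_iff₀ hpos]
      exact hb z hz
  refine le_trans ?_ (le_iSup₂ (f := fun f _ => growthExponent f) h hmem)
  refine le_sInf ?_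
  rintro _ ⟨s, ⟨h₁, g₁, hcan₁, hO⟩, rfl⟩
  rw [EReal.coe_le_coe_iff]
  by_contra! hst
  refine hgrowth s hst ?_
  have hcoeff : ∀ n, taylorCoeff p n = (n + 1) * taylorCoeff h₁ (n + 1) := fun n => by
    rw [← taylorCoeff_deriv, taylorCoeff_congr (hcan₁.deriv_eqOn hcan),
      taylorCoeff_congr hderiv]
  obtain ⟨C, hC0, hC⟩ := hO.exists_pos
  have hC' := (tendsto_add_atTop_nat 1).eventually hC.bound
  refine Asymptotics.IsBigO.of_bound (C * max 1 (2 ^ s)) ?_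
  filter_upwards [hC', eventually_ge_atTop 1] with n hn hn1
  have hn0 : (1 : ℝ) ≤ n := by exact_mod_cast hn1
  have hpos : (0 : ℝ) < (n + 1 : ℕ) := by positivity
  rw [Real.norm_of_nonneg (by positivity), Real.norm_of_nonneg (by positivity),
    Real.rpow_sub_one hpos.ne', mul_div_assoc', le_div_iff₀ hpos] at hn
  have h1 : ‖taylorCoeff p n‖ ≤ C * ((n + 1 : ℕ) : ℝ) ^ s := by
    rw [hcoeff, norm_mul, ← Nat.cast_add_one, Complex.norm_natCast]
    nlinarith [norm_nonneg (taylorCoeff g₁ (n + 1))]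
  have h2 : ((n + 1 : ℕ) : ℝ) ^ s ≤ max 1 (2 ^ s) * (n : ℝ) ^ s := by
    push_cast
    rcases le_total 0 s with hs | hs
    · refine le_trans ?_ (mul_le_mul_of_nonneg_right (le_max_right 1 (2 ^ s)) (by positivity))
      rw [← Real.mul_rpow (by norm_num) (by linarith)]
      exact Real.rpow_le_rpow (by linarith) (by linarith) hs
    · refine le_trans ?_ (mul_le_mul_of_nonneg_right (le_max_left 1 (2 ^ s)) (by positivity))
      rw [one_mul]
      exact Real.rpow_le_rpow_of_nonpos (by linarith) (by linarith) hs
  rw [Real.norm_of_nonneg (by positivity), mul_assoc]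
  exact h1.trans (mul_le_mul_of_nonneg_left h2 hC0.le)

/-! ### Extremal maps -/

theorem taylorCoeff_one_sub_cpow (lam : ℝ) (n : ℕ) :
    taylorCoeff (fun z => (1 - z) ^ (-(lam : ℂ))) n =
      ((∏ j ∈ Finset.range n, (lam + j)) / n.factorial : ℝ) := by
  have h1 := (Complex.one_div_one_sub_cpow_hasFPowerSeriesOnBall_zero (lam : ℂ)).hasFPowerSeriesAt
  simp only [one_div, ← Complex.cpow_neg] at h1
  rw [taylorCoeff_eq_of_hasFPowerSeriesAt h1, ← Ring.multichoose_eq]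
  have h2 := Ring.factorial_nsmul_multichoose_eq_ascPochhammer (lam : ℂ) n
  rw [Polynomial.ascPochhammer_smeval_eq_eval] at h2
  have h3 : ∀ n : ℕ, (ascPochhammer ℂ n).eval (lam : ℂ) = ∏ j ∈ Finset.range n, ((lam : ℂ) + j) := by
    intro n
    induction n with
    | zero => simp
    | succ n ih => rw [ascPochhammer_succ_eval, ih, Finset.prod_range_succ]
  have h4 : (n.factorial : ℂ) ≠ 0 := by exact_mod_cast n.factorial_ne_zero
  rw [h3, nsmul_eq_mul] at h2
  push_cast
  rw [eq_div_iff h4, ← h2, mul_comm]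

/-- The coefficients of `(1 - z)^(-lam)` grow like `n^(lam - 1)`, by Euler's limit formula for the
Gamma function. -/
theorem not_taylorCoeff_one_sub_cpow_isBigO {lam s : ℝ} (hlam : 0 < lam) (hs : s < lam - 1) :
    ¬ (fun n => taylorCoeff (fun z => (1 - z) ^ (-(lam : ℂ))) n) =O[atTop]
      (fun n : ℕ => (n : ℝ) ^ s) := by
  intro hO
  have hΓ : (fun n => Real.GammaSeq lam n) =O[atTop] (fun _ : ℕ => (1 : ℝ)) :=
    (Real.GammaSeq_tendsto_Gamma lam).isBigO_one ℝ
  have hlin : (fun n : ℕ => lam + n) =O[atTop] (fun n : ℕ => (n : ℝ) ^ (1 : ℝ)) := by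
    refine Asymptotics.IsBigO.of_bound (lam + 1) ?_
    filter_upwards [eventually_ge_atTop 1] with n hn
    have hn0 : (1 : ℝ) ≤ n := by exact_mod_cast hn
    rw [Real.rpow_one, Real.norm_of_nonneg (by positivity), Real.norm_of_nonneg (by positivity)]
    nlinarith
  have hprod := ((hO.norm_left.mul hlin).mul hΓ)
  have hle : (fun n : ℕ => (n : ℝ) ^ lam) =O[atTop] (fun n : ℕ => (n : ℝ) ^ (s + 1)) := by
    refine hprod.congr' (Eventually.of_forall fun n => ?_) ?_
    · have hpos : ∀ m : ℕ, 0 < ∏ j ∈ Finset.range m, (lam + (j : ℝ)) := fun m =>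
        Finset.prod_pos fun j _ => by positivity
      have hn := (hpos n).ne'
      have hln : lam + (n : ℝ) ≠ 0 := by positivity
      have hf : (n.factorial : ℝ) ≠ 0 := by exact_mod_cast n.factorial_ne_zero
      beta_reduce
      rw [taylorCoeff_one_sub_cpow, Complex.norm_real,
        Real.norm_of_nonneg (div_nonneg (hpos n).le (by positivity)), Real.GammaSeq,
        Finset.prod_range_succ]
      field_simp
    · filter_upwards [eventually_ge_atTop 1] with n hn
      have hn0 : (0 : ℝ) < n := by exact_mod_cast hn
      rw [Real.rpow_add hn0, mul_one]
  obtain ⟨C, hC⟩ := hle.bound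
  have htend : Tendsto (fun n : ℕ => (n : ℝ) ^ (lam - (s + 1))) atTop atTop :=
    (tendsto_rpow_atTop (by linarith)).comp tendsto_natCast_atTop_atTop
  obtain ⟨n, hn, hnC, hn1⟩ :=
    (hC.and ((htend.eventually_gt_atTop C).and (eventually_ge_atTop 1))).exists
  have hn0 : (0 : ℝ) < n := by exact_mod_cast hn1
  rw [Real.rpow_sub hn0, lt_div_iff₀ (by positivity)] at hnC
  rw [Real.norm_of_nonneg (by positivity), Real.norm_of_nonneg (by positivity)] at hn
  exact absurd hn (not_le.2 hnC)

theorem sub_one_le_classGrowthExponent {lam : ℝ} (hlam : 0 < lam) :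
    ((lam - 1 : ℝ) : EReal) ≤ classGrowthExponent (classBHZero lam) := by
  have hslit : ∀ z ∈ Metric.ball (0 : ℂ) 1, 1 - z ∈ Complex.slitPlane := fun z hz => by
    rw [sub_eq_add_neg]
    exact Complex.mem_slitPlane_of_norm_lt_one (by simpa using hz)
  have hd : ∀ z ∈ Metric.ball (0 : ℂ) 1, HasDerivAt (fun z => (1 - z) ^ (-(lam : ℂ)))
      (lam * (1 - z) ^ (-(lam : ℂ)) / (1 - z)) z := by
    intro z hz
    have h1 : HasDerivAt (fun z : ℂ => 1 - z) (-1) z := by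
      simpa using (hasDerivAt_id z).const_sub 1
    have h0 : 1 - z ≠ 0 := Complex.slitPlane_ne_zero (hslit z hz)
    refine (h1.cpow_const (c := -(lam : ℂ)) (hslit z hz)).congr_deriv ?_
    rw [Complex.cpow_sub _ _ h0, Complex.cpow_one]
    ring
  refine le_classGrowthExponent hlam
    (fun z hz => (hd z hz).differentiableAt.differentiableWithinAt) (by simp) (fun z hz => ?_)
    (fun z hz => ?_) fun s hs => not_taylorCoeff_one_sub_cpow_isBigO hlam hs
  · exact fun h => Complex.slitPlane_ne_zero (hslit z hz) ((Complex.cpow_eq_zero_iff _ _).1 h).1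
  · have hz1 : ‖z‖ < 1 := mem_ball_zero_iff.1 hz
    have hpos : 0 < ‖1 - z‖ := norm_pos_iff.2 (Complex.slitPlane_ne_zero (hslit z hz))
    have htri : 1 - ‖z‖ ≤ ‖1 - z‖ := by simpa using norm_sub_norm_le (1 : ℂ) z
    have hle : 1 - ‖z‖ ^ 2 ≤ 2 * ‖1 - z‖ := by nlinarith [norm_nonneg z]
    rw [(hd z hz).deriv, norm_div, norm_mul, Complex.norm_of_nonneg hlam.le, mul_div_assoc',
      div_le_iff₀ hpos]
    nlinarith [mul_nonneg hlam.le (norm_nonneg ((1 - z) ^ (-(lam : ℂ))))]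

theorem succ_mul_pow_mul_one_sub_le {r : ℝ} (hr : r ∈ Ico (0 : ℝ) 1) (n : ℕ) :
    (n + 1) * r ^ n * (1 - r) ≤ 1 := by
  have h1 : (n + 1) * r ^ n ≤ ∑ i ∈ Finset.range (n + 1), r ^ i := by
    have : ∑ _i ∈ Finset.range (n + 1), r ^ n ≤ ∑ i ∈ Finset.range (n + 1), r ^ i :=
      Finset.sum_le_sum fun i hi => pow_le_pow_of_le_one hr.1 hr.2.le
        (Nat.lt_succ_iff.1 (Finset.mem_range.1 hi))
    simpa using this
  have h2 := geom_sum_mul_neg r (n + 1)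
  nlinarith [mul_le_mul_of_nonneg_right h1 (sub_nonneg.2 hr.2.le), pow_nonneg hr.1 (n + 1)]

/-- `1 + ∑ cₙ zⁿ` with small absolutely summable coefficients is the derivative of a member of the
class, however large the gaps between its nonzero coefficients are. -/
theorem le_classGrowthExponent_of_hasSum {c : ℕ → ℝ} {lam t : ℝ} (hlam : 0 < lam)
    (hc0 : ∀ n, 0 ≤ c n) (hc00 : c 0 = 0) (hc : HasSum c (lam / (1 + lam)))
    (hgrowth : ∀ s < t, ¬ c =O[atTop] (fun n : ℕ => (n : ℝ) ^ s)) :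
    (t : EReal) ≤ classGrowthExponent (classBHZero lam) := by
  set σ := lam / (1 + lam) with hσ
  have hcs : ∀ r ∈ Ico (0 : ℝ) 1, Summable (fun n => ‖(c n : ℂ)‖ * r ^ n) := by
    intro r hr
    refine Summable.of_nonneg_of_le (fun n => by have := hr.1; positivity) (fun n => ?_) hc.summable
    rw [Complex.norm_of_nonneg (hc0 n)]
    exact mul_le_of_le_one_right (hc0 n) (pow_le_one₀ hr.1 hr.2.le)
  set q : ℂ → ℂ := fun z => ∑' n, (c n : ℂ) * z ^ n with hq
  have hqd : DifferentiableOn ℂ q (Metric.ball 0 1) := differentiableOn_tsum_mul_pow hcs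
  have hqb : ∀ z ∈ Metric.ball (0 : ℂ) 1, ‖q z‖ ≤ σ := by
    intro z hz
    refine tsum_of_norm_bounded hc fun n => ?_
    rw [norm_mul, Complex.norm_of_nonneg (hc0 n), norm_pow]
    exact mul_le_of_le_one_right (hc0 n)
      (pow_le_one₀ (norm_nonneg z) (mem_ball_zero_iff.1 hz).le)
  have hσ1 : σ = lam * (1 - σ) := by rw [hσ]; field_simp; ring
  have hσ0 : 0 < σ := by positivity
  have hσ2 : 0 < 1 - σ := by
    by_contra! h
    nlinarith
  have hpb : ∀ z ∈ Metric.ball (0 : ℂ) 1, 1 - σ ≤ ‖1 + q z‖ := by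
    intro z hz
    have := norm_sub_norm_le (1 : ℂ) (-q z)
    rw [norm_one, norm_neg, sub_neg_eq_add] at this
    linarith [hqb z hz]
  refine le_classGrowthExponent (p := fun z => 1 + q z) hlam (hqd.const_add 1) ?_
    (fun z hz h => ?_) (fun z hz => ?_) fun s hs hO => hgrowth s hs ?_
  · have : q 0 = 0 := by
      simp only [hq]
      refine (tsum_congr fun n => ?_).trans tsum_zero
      rcases n with _ | n <;> simp [hc00]
    simp [this]
  · have := hpb z hz
    rw [h, norm_zero] at this
    linarith
  · have hz1 : ‖z‖ < 1 := mem_ball_zero_iff.1 hz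
    have hw : 0 < 1 - ‖z‖ ^ 2 := by nlinarith [norm_nonneg z]
    have hder := hasSum_taylorCoeff (hqd.deriv Metric.isOpen_ball) hz
    have hshift : HasSum (fun n => c (n + 1)) σ := by
      simpa [hc00] using (hasSum_nat_add_iff' (f := c) 1).2 hc
    have hq' : ‖deriv q z‖ ≤ 2 * σ / (1 - ‖z‖ ^ 2) := by
      rw [← hder.tsum_eq]
      refine tsum_of_norm_bounded ((hshift.mul_left 2).div_const _) fun n => ?_
      rw [taylorCoeff_deriv, taylorCoeff_tsum_mul_pow hcs, norm_mul, norm_mul, norm_pow,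
        Complex.norm_of_nonneg (hc0 _), ← Nat.cast_add_one, Complex.norm_natCast, le_div_iff₀ hw]
      have h1 := succ_mul_pow_mul_one_sub_le ⟨norm_nonneg z, hz1⟩ n
      have h2 : ((n : ℝ) + 1) * ‖z‖ ^ n * (1 - ‖z‖ ^ 2) ≤ 2 := by
        have h3 := mul_le_mul h1 (by linarith : 1 + ‖z‖ ≤ 2) (by positivity) one_pos.le
        calc ((n : ℝ) + 1) * ‖z‖ ^ n * (1 - ‖z‖ ^ 2)
            = (n + 1) * ‖z‖ ^ n * (1 - ‖z‖) * (1 + ‖z‖) := by ring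
          _ ≤ 2 := by linarith
      have h4 := mul_le_mul_of_nonneg_left h2 (hc0 (n + 1))
      push_cast
      linarith
    rw [le_div_iff₀ hw] at hq'
    have e : deriv (fun z => 1 + q z) z = deriv q z := deriv_const_add _
    rw [e]
    have := mul_le_mul_of_nonneg_left (hpb z hz) hlam.le
    linarith
  · refine Asymptotics.IsBigO.trans (Eventually.isBigO ?_) hO.norm_left
    filter_upwards [eventually_ge_atTop 1] with n hn
    obtain ⟨m, rfl⟩ := Nat.exists_eq_add_of_le' hn
    have h1 : deriv (fun z => 1 + q z) = deriv q := by
      ext z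
      exact deriv_const_add _
    have h2 := taylorCoeff_deriv (fun z => 1 + q z) m
    rw [h1, taylorCoeff_deriv] at h2
    have h3 : ((m : ℂ) + 1) ≠ 0 := by exact_mod_cast m.succ_ne_zero
    rw [← mul_left_cancel₀ h3 h2, taylorCoeff_tsum_mul_pow hcs, Complex.norm_real]

theorem zero_le_classGrowthExponent {lam : ℝ} (hlam : 0 < lam) :
    ((0 : ℝ) : EReal) ≤ classGrowthExponent (classBHZero lam) := by
  -- gaps so large that the summable coefficients `2^(-k)` beat every negative power
  let m : ℕ → ℕ := fun k => 2 ^ k ^ 2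
  have hm : Function.Injective m := fun j k h => by
    have := Nat.pow_right_injective le_rfl h
    exact Nat.pow_left_injective two_ne_zero this
  set ε := lam / (1 + lam) / 2 with hε
  have hε0 : 0 < ε := by positivity
  set c : ℕ → ℝ := Function.extend m (fun k => ε * (1 / 2) ^ k) 0 with hc
  have hcm : ∀ k, c (m k) = ε * (1 / 2) ^ k := fun k => hm.extend_apply _ _ k
  have hcout : ∀ n, n ∉ range m → c n = 0 := fun n hn =>
    Function.extend_apply' _ _ _ hn
  refine le_classGrowthExponent_of_hasSum (c := c) hlam (fun n => ?_) ?_ ?_ ?_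
  · by_cases hn : n ∈ range m
    · obtain ⟨k, rfl⟩ := hn
      rw [hcm]
      positivity
    · exact (hcout n hn).ge
  · refine hcout 0 ?_
    rintro ⟨k, hk⟩
    exact absurd hk (by positivity)
  · rw [← hm.hasSum_iff hcout]
    have h := hasSum_geometric_two.mul_left ε
    rw [hε, div_mul_cancel₀ _ two_ne_zero] at h
    exact h.congr_fun hcm
  · intro s hs hO
    obtain ⟨C, hC0, hC⟩ := hO.exists_pos
    have hmt : Tendsto m atTop atTop := hm.nat_tendsto_atTop
    have hzero : Tendsto (fun k : ℕ => C * (1 / 2 : ℝ) ^ k) atTop (𝓝 0) := by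
      simpa using (tendsto_pow_atTop_nhds_zero_of_lt_one (r := (1 / 2 : ℝ)) (by norm_num)
        (by norm_num)).const_mul C
    have hev := ((hmt.eventually hC.bound).and ((hzero.eventually_lt_const hε0).and
      (tendsto_natCast_atTop_atTop.eventually_ge_atTop (2 / -s)))).exists
    obtain ⟨k, hk1, hk2, hk3⟩ := hev
    rw [div_le_iff₀ (by linarith)] at hk3
    have hk0 : (0 : ℝ) ≤ k := k.cast_nonneg
    have hpow : ((m k : ℕ) : ℝ) ^ s ≤ (1 / 2 : ℝ) ^ k * (1 / 2) ^ k := by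
      have e1 : ((m k : ℕ) : ℝ) ^ s = (2 : ℝ) ^ ((k : ℝ) ^ 2 * s) := by
        rw [Real.rpow_mul (by norm_num), ← Nat.cast_pow, Real.rpow_natCast]
        simp [m]
      have e2 : (1 / 2 : ℝ) ^ k * (1 / 2) ^ k = (2 : ℝ) ^ (-(2 * k : ℝ)) := by
        rw [← mul_pow, Real.rpow_neg (by norm_num), Real.rpow_mul (by norm_num), Real.rpow_natCast,
          ← inv_pow]
        norm_num
      rw [e1, e2]
      exact Real.rpow_le_rpow_of_exponent_le (by norm_num) (by nlinarith)
    rw [hcm, Real.norm_of_nonneg (by positivity), Real.norm_of_nonneg (by positivity)] at hk1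
    have hhalf : (0 : ℝ) < (1 / 2) ^ k := by positivity
    have h1 := hk1.trans (mul_le_mul_of_nonneg_left hpow hC0.le)
    rw [← mul_assoc] at h1
    exact absurd (le_of_mul_le_mul_right h1 hhalf) (not_le.2 hk2)

theorem max_le_classGrowthExponent {lam : ℝ} (hlam : 0 < lam) :
    ((max (lam - 1) 0 : ℝ) : EReal) ≤ classGrowthExponent (classBHZero lam) := by
  rcases max_choice (lam - 1) 0 with h | h <;> rw [h]
  · exact sub_one_le_classGrowthExponent hlam
  · exact zero_le_classGrowthExponent hlam

theorem classGrowthExponent_classBHZero_le_classBH (lam : ℝ) :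
    classGrowthExponent (classBHZero lam) ≤ classGrowthExponent (classBH lam) :=
  biSup_mono fun _ hf => hf.1

theorem toReal_isBigO_sq {F : ℝ → EReal}
    (hF : ∀ lam : ℝ, 0 < lam → ((max (lam - 1) 0 : ℝ) : EReal) ≤ F lam ∧
      F lam ≤ (alpha lam : EReal)) :
    (fun lam : ℝ => (F lam).toReal) =O[𝓝[>] 0] (fun lam : ℝ => lam ^ 2) := by
  refine Asymptotics.IsBigO.of_bound 1 ?_
  filter_upwards [self_mem_nhdsWithin] with lam hlam
  obtain ⟨h1, h2⟩ := hF lam hlam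
  have h0 : (0 : EReal) ≤ F lam := le_trans (by exact_mod_cast le_max_right _ _) h1
  have hbot : F lam ≠ ⊥ := fun h => by simp [h] at h0
  have h3 : (F lam).toReal ≤ alpha lam := EReal.toReal_le_toReal h2 hbot (EReal.coe_ne_top _)
  rw [Real.norm_of_nonneg (EReal.toReal_nonneg h0), Real.norm_of_nonneg (by positivity), one_mul]
  exact h3.trans (alpha_le_sq lam)

end HarmonicDisk

/-- The bounds are stated for the whole class and also for its members with `b₁ = 0`. They make both
exponents finite for every `lam > 0`, so that `EReal.toReal` below does not change their values. -/
theorem theorem5p2 :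
    ((∀ lam : ℝ, 0 < lam →
        ((max (lam - 1) 0 : ℝ) : EReal) ≤
            HarmonicDisk.classGrowthExponent (HarmonicDisk.classBH lam) ∧
          HarmonicDisk.classGrowthExponent (HarmonicDisk.classBH lam) ≤
            (HarmonicDisk.alpha lam : EReal)) ∧
      (fun lam : ℝ =>
          (HarmonicDisk.classGrowthExponent (HarmonicDisk.classBH lam)).toReal)
        =O[𝓝[>] 0] (fun lam : ℝ => lam ^ 2)) ∧
    ((∀ lam : ℝ, 0 < lam →
        ((max (lam - 1) 0 : ℝ) : EReal) ≤
            HarmonicDisk.classGrowthExponent (HarmonicDisk.classBHZero lam) ∧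
          HarmonicDisk.classGrowthExponent (HarmonicDisk.classBHZero lam) ≤
            (HarmonicDisk.alpha lam : EReal)) ∧
      (fun lam : ℝ =>
          (HarmonicDisk.classGrowthExponent (HarmonicDisk.classBHZero lam)).toReal)
        =O[𝓝[>] 0] (fun lam : ℝ => lam ^ 2)) := by
  have hB : ∀ lam : ℝ, 0 < lam →
      ((max (lam - 1) 0 : ℝ) : EReal) ≤
          HarmonicDisk.classGrowthExponent (HarmonicDisk.classBH lam) ∧
        HarmonicDisk.classGrowthExponent (HarmonicDisk.classBH lam) ≤
          (HarmonicDisk.alpha lam : EReal) := fun lam hlam =>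
    ⟨(HarmonicDisk.max_le_classGrowthExponent hlam).trans
      (HarmonicDisk.classGrowthExponent_classBHZero_le_classBH lam),
      HarmonicDisk.classGrowthExponent_classBH_le hlam⟩
  have hB0 : ∀ lam : ℝ, 0 < lam →
      ((max (lam - 1) 0 : ℝ) : EReal) ≤
          HarmonicDisk.classGrowthExponent (HarmonicDisk.classBHZero lam) ∧
        HarmonicDisk.classGrowthExponent (HarmonicDisk.classBHZero lam) ≤
          (HarmonicDisk.alpha lam : EReal) := fun lam hlam =>
    ⟨HarmonicDisk.max_le_classGrowthExponent hlam,
      (HarmonicDisk.classGrowthExponent_classBHZero_le_classBH lam).trans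
        (HarmonicDisk.classGrowthExponent_classBH_le hlam)⟩
  exact ⟨⟨hB, HarmonicDisk.toReal_isBigO_sq hB⟩, hB0, HarmonicDisk.toReal_isBigO_sq hB0⟩
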